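/- Let $d\ge 0$ be an integer. For $m\ge 0$ let $C_b(\mathbb R^m)$ be the space of bounded continuous functions $\mathbb R^m\to\mathbb C$. Put $\wedge(t)=\prod_{j=1}^{m}\max(1-2|t^{(j)}|,0)$ and $\psi_n(t)=\wedge(t-\tfrac12 n)$ for $t\in\mathbb R^m$, $n\in\mathbb Z^m$, and let the Wiener algebra be $$W(\mathbb R^m)=\Big\{f\in C_b(\mathbb R^m)\;:\;\sum_{n\in\mathbb Z^m}\|f\,\psi_n\|_\infty<\infty\Big\}.$$ Let $\mathcal F f(s)=\hat f(s)=\int_{\mathbb R^d}f(t)\,e^{-2\pi i s\cdot t}\,dt$, let $g_0(t)=e^{-\pi t\cdot t}$ on $\mathbb R^d$, and for $f\in C_b(\mathbb R^d)$ let $$\mathcal V_{g_0}f(x,\omega)=\int_{\mathbb R^d}f(t)\,\overline{g_0(t-x)}\,e^{-2\pi i\omega\cdot t}\,dt,\qquad (x,\omega)\in\mathbb R^{2d}.$$ Define $$S_0(\mathbb R^d)=\{f\in C_b(\mathbb R^d):\mathcal V_{g_0}f\in W(\mathbb R^{2d})\},\qquad \|f\|_{S_0}=\int_{\mathbb R^{2d}}|\mathcal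 V_{g_0}f(x,\omega)|\,d(x,\omega)=\|\mathcal V_{g_0}f\|_1 .$$ **Theorem.** The linear space $S_0(\mathbb R^d)$ with $\|\cdot\|_{S_0}$ is a Banach space (the integral defining the norm converges for every $f\in S_0(\mathbb R^d)$). Moreover: 1. Every $f\in S_0(\mathbb R^d)$ belongs to $W(\mathbb R^d)$ and is integrable, so that its Fourier transform is defined, and $\mathcal F$ is a linear isometric bijection of $S_0(\mathbb R^d)$ onto itself. 2. For all $x,\omega\in\mathbb R^d$, the time-frequency shift $f\mapsto\big(t\mapsto e^{2\pi i\omega\cdot t}f(t-x)\big)$ is a linear isometric bijection of $S_0(\mathbb R^d)$ onto itself. 3. $S_0(\mathbb R^d)$ is a Banach algebra under pointwise multiplication, and also under convolution $(f_1*f_2)(t)=\int_{\mathbb R^d}f_2(t-s)\,f_1(s)\,ds$ (an absolutely convergent integral for every $t$): for $f_1,f_2\in S_0(\mathbb R^d)$ the functions $f_1\cdot f_2$ and $f_1*f_2$ belong to $S_0(\mathbb R^d)$, both products are bilinear and associative, and $$\|f_1\cdot f_2\|_{S_0}\le\|f_1\|_{S_0}\|f_2\|_{S_0},\qquad \|f_1*f_2\|_{S_0}\le\|f_1\|_{S_0}\|f_2\|_{S_0}.$$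 -/

import Mathlib

open MeasureTheory
open scoped ENNReal FourierTransform Convolution BoundedContinuousFunction

namespace Feichtinger

/-- The tent function `t ↦ ∏ⱼ max (1 - 2|tⱼ|, 0)` on `ℝ^ι`. -/
noncomputable def tent {ι : Type*} [Fintype ι] (t : EuclideanSpace ℝ ι) : ℝ :=
  ∏ j, max (1 - 2 * |t j|) 0

/-- The partition of unity `ψₙ(t) = tent (t - n/2)`, for `n ∈ ℤ^ι`. -/
noncomputable def psi {ι : Type*} [Fintype ι] (n : ι → ℤ) (t : EuclideanSpace ℝ ι) : ℝ :=
  tent (t - WithLp.toLp 2 (fun j => (n j : ℝ) / 2))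

/-- The Wiener norm `∑ₙ ‖f ψₙ‖_∞`, with values in `[0, ∞]`. -/
noncomputable def wienerNorm {ι : Type*} [Fintype ι] (f : EuclideanSpace ℝ ι → ℂ) : ℝ≥0∞ :=
  ∑' n : ι → ℤ, ⨆ t : EuclideanSpace ℝ ι, ‖f t * (psi n t : ℂ)‖ₑ

/-- The Wiener algebra `W(ℝ^ι)`: bounded continuous functions of finite Wiener norm. -/
structure MemWiener {ι : Type*} [Fintype ι] (f : EuclideanSpace ℝ ι → ℂ) : Prop where
  continuous : Continuous f
  bounded : ∃ C : ℝ, ∀ t, ‖f t‖ ≤ C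
  wienerNorm_lt_top : wienerNorm f < ∞

/-- The Gaussian `g₀(t) = exp (-π t·t)`. -/
noncomputable def gaussian {ι : Type*} [Fintype ι] (t : EuclideanSpace ℝ ι) : ℂ :=
  Complex.exp (-(Real.pi : ℂ) * (‖t‖ : ℂ) ^ 2)

/-- The phase space `ℝ^{2d}`; `Sum.inl` indexes the time coordinates `x`, `Sum.inr` the
frequency coordinates `ω`. -/
abbrev PhaseSpace (d : ℕ) : Type := EuclideanSpace ℝ (Fin d ⊕ Fin d)

/-- The time component `x` of a point `(x, ω)` of phase space. -/
def time {d : ℕ} (z : PhaseSpace d) : EuclideanSpace ℝ (Fin d) :=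
  WithLp.toLp 2 (fun j => z (Sum.inl j))

/-- The frequency component `ω` of a point `(x, ω)` of phase space. -/
def freq {d : ℕ} (z : PhaseSpace d) : EuclideanSpace ℝ (Fin d) :=
  WithLp.toLp 2 (fun j => z (Sum.inr j))

/-- The short-time Fourier transform `V_g f (x, ω) = ∫ f(t) conj(g(t - x)) e^{-2πi ω·t} dt`. -/
noncomputable def stft {d : ℕ} (g f : EuclideanSpace ℝ (Fin d) → ℂ) (z : PhaseSpace d) : ℂ :=
  𝓕 (fun t => f t * starRingEnd ℂ (g (t - time z))) (freq z)

/-! Linearity of the membership condition, needed to speak of `S₀` as a vector space. -/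

theorem MemWiener.zero {ι : Type*} [Fintype ι] :
    MemWiener (fun _ : EuclideanSpace ℝ ι => (0 : ℂ)) :=
  ⟨continuous_const, ⟨0, by simp⟩, by simp [wienerNorm]⟩

theorem MemWiener.add {ι : Type*} [Fintype ι] {f g : EuclideanSpace ℝ ι → ℂ}
    (hf : MemWiener f) (hg : MemWiener g) : MemWiener (fun t => f t + g t) := by
  refine ⟨hf.continuous.add hg.continuous, ?_, ?_⟩
  · obtain ⟨C, hC⟩ := hf.bounded
    obtain ⟨D, hD⟩ := hg.bounded
    exact ⟨C + D, fun t => (norm_add_le _ _).trans (add_le_add (hC t) (hD t))⟩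
  · refine lt_of_le_of_lt ?_ (ENNReal.add_lt_top.2 ⟨hf.wienerNorm_lt_top, hg.wienerNorm_lt_top⟩)
    unfold wienerNorm
    rw [← ENNReal.tsum_add]
    refine ENNReal.tsum_le_tsum fun n => iSup_le fun t => ?_
    rw [add_mul]
    exact (enorm_add_le _ _).trans (add_le_add
      (le_iSup (fun t => ‖f t * (psi n t : ℂ)‖ₑ) t) (le_iSup (fun t => ‖g t * (psi n t : ℂ)‖ₑ) t))

theorem MemWiener.const_mul {ι : Type*} [Fintype ι] {f : EuclideanSpace ℝ ι → ℂ}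
    (c : ℂ) (hf : MemWiener f) : MemWiener (fun t => c * f t) := by
  refine ⟨continuous_const.mul hf.continuous, ?_, ?_⟩
  · obtain ⟨C, hC⟩ := hf.bounded
    exact ⟨‖c‖ * C, fun t => by
      rw [norm_mul]; exact mul_le_mul_of_nonneg_left (hC t) (norm_nonneg c)⟩
  · refine lt_of_le_of_lt ?_ (ENNReal.mul_lt_top (enorm_lt_top (x := c)) hf.wienerNorm_lt_top)
    unfold wienerNorm
    rw [← ENNReal.tsum_mul_left]
    refine ENNReal.tsum_le_tsum fun n => iSup_le fun t => ?_
    rw [mul_assoc, enorm_mul]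
    exact mul_le_mul_right (le_iSup (fun t => ‖f t * (psi n t : ℂ)‖ₑ) t) _

theorem integrable_gaussian {d : ℕ} :
    Integrable (gaussian : EuclideanSpace ℝ (Fin d) → ℂ) := by
  have h := GaussianFourier.integrable_cexp_neg_mul_sq_norm_add
    (V := EuclideanSpace ℝ (Fin d)) (b := (Real.pi : ℂ)) (by simpa using Real.pi_pos) 0 0
  refine h.congr (Filter.Eventually.of_forall fun t => ?_)
  simp [gaussian]

theorem integrable_mul_gaussian {d : ℕ} (f : EuclideanSpace ℝ (Fin d) →ᵇ ℂ)
    (x : EuclideanSpace ℝ (Fin d)) :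
    Integrable (fun t => f t * starRingEnd ℂ (gaussian (t - x))) := by
  have h : Integrable (fun t => starRingEnd ℂ (gaussian (t - x))) :=
    (RCLike.conjCLE (K := ℂ)).toContinuousLinearMap.integrable_comp
      ((integrable_gaussian (d := d)).comp_sub_right x)
  exact h.bdd_mul f.continuous.aestronglyMeasurable
    (Filter.Eventually.of_forall fun t => f.norm_coe_le_norm t)

/-- `S₀(ℝᵈ)` as a linear subspace of `C_b(ℝᵈ)`: the functions `f ∈ C_b(ℝᵈ)` for which
`V_{g₀} f` belongs to `W(ℝ^{2d})`. -/
noncomputable def S0Submodule (d : ℕ) : Submodule ℂ (EuclideanSpace ℝ (Fin d) →ᵇ ℂ) where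
  carrier := {f | MemWiener (stft gaussian f)}
  zero_mem' := by
    have h : stft (d := d) gaussian ⇑(0 : EuclideanSpace ℝ (Fin d) →ᵇ ℂ) = fun _ => 0 := by
      funext z
      simp [stft, Real.fourier_eq]
    change MemWiener _
    rw [h]
    exact MemWiener.zero
  add_mem' := by
    intro f g hf hg
    have h : stft (d := d) gaussian ⇑(f + g)
        = fun z => stft gaussian f z + stft gaussian g z := by
      funext z
      simp only [stft, Real.fourier_eq, BoundedContinuousFunction.coe_add, Pi.add_apply,
        add_mul, smul_add]
      refine integral_add ?_ ?_
      · exact (Real.fourierIntegral_convergent_iff _).2 (integrable_mul_gaussian f _)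
      · exact (Real.fourierIntegral_convergent_iff _).2 (integrable_mul_gaussian g _)
    change MemWiener _
    rw [h]
    exact MemWiener.add hf hg
  smul_mem' := by
    intro c f hf
    have h : stft (d := d) gaussian ⇑(c • f) = fun z => c * stft gaussian f z := by
      funext z
      simp only [stft, Real.fourier_eq, BoundedContinuousFunction.coe_smul, smul_eq_mul,
        mul_assoc]
      rw [← integral_const_mul]
      refine integral_congr_ae (Filter.Eventually.of_forall fun t => ?_)
      simp only [mul_smul_comm]
    change MemWiener _
    rw [h]
    exact MemWiener.const_mul c hf

/-- The vector space `S₀(ℝᵈ)`. It is a type of its own, so that it does not inherit the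
supremum norm of `C_b(ℝᵈ)`. -/
def S0 (d : ℕ) : Type := ↥(S0Submodule d)

noncomputable instance (d : ℕ) : AddCommGroup (S0 d) :=
  inferInstanceAs (AddCommGroup ↥(S0Submodule d))

noncomputable instance (d : ℕ) : Module ℂ (S0 d) :=
  inferInstanceAs (Module ℂ ↥(S0Submodule d))

/-- An element of `S₀(ℝᵈ)` as a bounded continuous function. -/
noncomputable def S0.toBCF {d : ℕ} (f : S0 d) : EuclideanSpace ℝ (Fin d) →ᵇ ℂ := f.1

noncomputable instance (d : ℕ) : CoeFun (S0 d) (fun _ => EuclideanSpace ℝ (Fin d) → ℂ) :=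
  ⟨fun f => ⇑f.toBCF⟩

/-- The norm `‖f‖_{S₀} = ∫_{ℝ^{2d}} |V_{g₀} f (x, ω)| d(x, ω)`. -/
noncomputable instance (d : ℕ) : Norm (S0 d) :=
  ⟨fun f => ∫ z : PhaseSpace d, ‖stft gaussian f z‖⟩

end Feichtinger

namespace Feichtinger

/-! ### Gaussian integrals -/

open scoped RealInnerProductSpace

/-! Everything rests on inversion of the short-time Fourier transform with a second weight `h` left
free (`mul_integral_eq_integral_stft`): if `V f` is integrable, then `f(t) ∫ g₀ h = ∫ V f(x, ω)
e^{2πi ω·t} h(t - x)`.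

The choice `h = g₀` writes `f` as an L¹ superposition of time-frequency shifted Gaussians. Applying
`V` gives a reproducing formula whose kernel has Gaussian decay in `z - w`. Superposing translated
Gaussians with an integrable weight gives finite Wiener norm, so for bounded continuous `f`
integrability of `V f` alone forces `V f` and `f` into the Wiener algebras. Since Wiener functions
are integrable, `S₀` is exactly the set of `f` with `V f ∈ L¹`, and membership reduces to L¹
estimates.

The choice `h = 1`, with `∫ g₀ = 1`, gives `‖f‖_∞ ≤ ‖f‖_{S₀}`, hence definiteness and, with Fatou,
completeness. It also exhibits `V(f₁ f₂)` as an average of frequency translates of `V f₂` with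
weight `V f₁`, whence the product inequality with constant one.

Up to unimodular factors, the Fourier transform and time-frequency shifts act on `V f` by a rotation
and a translation of phase space, so they are isometries. Convolution is the pointwise product
transported by the Fourier transform. -/

theorem gaussian_eq_ofReal {ι : Type*} [Fintype ι] (t : EuclideanSpace ℝ ι) :
    gaussian t = ((Real.exp (-Real.pi * ‖t‖ ^ 2) : ℝ) : ℂ) := by
  simp [gaussian]

theorem norm_gaussian {ι : Type*} [Fintype ι] (t : EuclideanSpace ℝ ι) :
    ‖gaussian t‖ = Real.exp (-Real.pi * ‖t‖ ^ 2) := by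
  rw [gaussian_eq_ofReal, Complex.norm_real, Real.norm_eq_abs,
    Real.abs_exp]

theorem norm_gaussian_le_one {ι : Type*} [Fintype ι] (t : EuclideanSpace ℝ ι) :
    ‖gaussian t‖ ≤ 1 := by
  rw [norm_gaussian, Real.exp_le_one_iff]
  nlinarith [Real.pi_pos, sq_nonneg ‖t‖]

theorem conj_gaussian {ι : Type*} [Fintype ι] (t : EuclideanSpace ℝ ι) :
    starRingEnd ℂ (gaussian t) = gaussian t := by
  rw [gaussian_eq_ofReal, Complex.conj_ofReal]

theorem continuous_gaussian {ι : Type*} [Fintype ι] :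
    Continuous (gaussian : EuclideanSpace ℝ ι → ℂ) := by
  unfold gaussian
  fun_prop

theorem integral_gaussian {d : ℕ} : ∫ t : EuclideanSpace ℝ (Fin d), gaussian t = 1 := by
  have h := GaussianFourier.integral_cexp_neg_mul_sq_norm (V := EuclideanSpace ℝ (Fin d))
    (b := (Real.pi : ℂ)) (by simpa using Real.pi_pos)
  simp only [gaussian]
  rw [h, div_self (by exact_mod_cast Real.pi_ne_zero), Complex.one_cpow]

theorem integral_norm_gaussian {d : ℕ} : ∫ t : EuclideanSpace ℝ (Fin d), ‖gaussian t‖ = 1 := by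
  simp only [norm_gaussian]
  rw [GaussianFourier.integral_rexp_neg_mul_sq_norm Real.pi_pos, div_self Real.pi_ne_zero,
    Real.one_rpow]

theorem fourier_gaussian {d : ℕ} :
    𝓕 (gaussian : EuclideanSpace ℝ (Fin d) → ℂ) = gaussian := by
  funext w
  have h := fourier_gaussian_innerProductSpace (V := EuclideanSpace ℝ (Fin d))
    (b := (Real.pi : ℂ)) (by simpa using Real.pi_pos) w
  have hpi : (Real.pi : ℂ) ≠ 0 := by exact_mod_cast Real.pi_ne_zero
  change 𝓕 (fun v : EuclideanSpace ℝ (Fin d) => Complex.exp (-(Real.pi : ℂ) * (‖v‖ : ℂ) ^ 2)) w = _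
  rw [h, div_self hpi, Complex.one_cpow, one_mul, gaussian]
  congr 1
  field_simp

/-- The inversion formula with weight `g₀` is divided by this constant; only its nonvanishing
matters. -/
theorem integral_gaussian_mul_gaussian_ne_zero {d : ℕ} :
    ∫ t : EuclideanSpace ℝ (Fin d), gaussian t * gaussian t ≠ 0 := by
  have h := GaussianFourier.integral_cexp_neg_mul_sq_norm (V := EuclideanSpace ℝ (Fin d))
    (b := ((2 * Real.pi : ℝ) : ℂ)) (by simpa using Real.pi_pos)
  have h2 : (fun t : EuclideanSpace ℝ (Fin d) => gaussian t * gaussian t)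
      = fun t => Complex.exp (-((2 * Real.pi : ℝ) : ℂ) * (‖t‖ : ℂ) ^ 2) := by
    funext t
    rw [gaussian, ← Complex.exp_add]
    congr 1
    push_cast
    ring
  rw [h2, h]
  have hpi : (Real.pi : ℂ) ≠ 0 := by exact_mod_cast Real.pi_ne_zero
  refine (Complex.cpow_ne_zero_iff).2 (Or.inl ?_)
  refine div_ne_zero hpi ?_
  push_cast
  exact mul_ne_zero two_ne_zero hpi

/-! ### Phase space as a product -/

/-- The point `(x, ω)` of phase space. -/
def phasePoint {d : ℕ} (x ω : EuclideanSpace ℝ (Fin d)) : PhaseSpace d :=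
  WithLp.toLp 2 (Sum.elim x ω)

@[simp] theorem time_phasePoint {d : ℕ} (x ω : EuclideanSpace ℝ (Fin d)) :
    time (phasePoint x ω) = x := rfl

@[simp] theorem freq_phasePoint {d : ℕ} (x ω : EuclideanSpace ℝ (Fin d)) :
    freq (phasePoint x ω) = ω := rfl

theorem phasePoint_time_freq {d : ℕ} (z : PhaseSpace d) : phasePoint (time z) (freq z) = z := by
  ext i
  cases i <;> rfl

theorem time_sub {d : ℕ} (z w : PhaseSpace d) : time (z - w) = time z - time w := rfl

theorem freq_sub {d : ℕ} (z w : PhaseSpace d) : freq (z - w) = freq z - freq w := rfl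

theorem continuous_time {d : ℕ} : Continuous (time : PhaseSpace d → _) := by
  unfold time
  fun_prop

theorem continuous_freq {d : ℕ} : Continuous (freq : PhaseSpace d → _) := by
  unfold freq
  fun_prop

theorem continuous_phasePoint {d : ℕ} :
    Continuous (fun p : EuclideanSpace ℝ (Fin d) × EuclideanSpace ℝ (Fin d) =>
      phasePoint p.1 p.2) := by
  unfold phasePoint
  refine (PiLp.continuous_toLp 2 _).comp (continuous_pi ?_)
  rintro (i | i) <;> simp only [Sum.elim_inl, Sum.elim_inr] <;> fun_prop

attribute [fun_prop] continuous_gaussian continuous_time continuous_freq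

theorem norm_sq_eq_time_add_freq {d : ℕ} (z : PhaseSpace d) :
    ‖z‖ ^ 2 = ‖time z‖ ^ 2 + ‖freq z‖ ^ 2 := by
  simp only [EuclideanSpace.norm_sq_eq, Fintype.sum_sum_type, time, freq]

/-- Phase space as the product of the time space and the frequency space. -/
noncomputable def phaseEquiv (d : ℕ) :
    PhaseSpace d ≃ᵐ EuclideanSpace ℝ (Fin d) × EuclideanSpace ℝ (Fin d) where
  toFun z := (time z, freq z)
  invFun p := phasePoint p.1 p.2
  left_inv := phasePoint_time_freq
  right_inv _ := rfl
  measurable_toFun := (continuous_time.prodMk continuous_freq).measurable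
  measurable_invFun := continuous_phasePoint.measurable

theorem measurePreserving_phaseEquiv (d : ℕ) : MeasurePreserving (phaseEquiv d) := by
  have h1 := (PiLp.sumPiLpEquivProdLpPiLp (𝕜 := ℝ) (ι := Fin d) (κ := Fin d) 2
    (fun _ => ℝ)).measurePreserving
  have h2 := WithLp.volume_preserving_ofLp
    (EuclideanSpace ℝ (Fin d)) (EuclideanSpace ℝ (Fin d))
  exact h2.comp h1

theorem integrable_comp_phasePoint {d : ℕ} {F : PhaseSpace d → ℂ} (hF : Integrable F) :
    Integrable (fun p : EuclideanSpace ℝ (Fin d) × EuclideanSpace ℝ (Fin d) =>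
      F (phasePoint p.1 p.2)) (volume.prod volume) :=
  (measurePreserving_phaseEquiv d).symm.integrable_comp_of_integrable hF

theorem integral_comp_phasePoint {d : ℕ} (F : PhaseSpace d → ℂ) :
    ∫ p : EuclideanSpace ℝ (Fin d) × EuclideanSpace ℝ (Fin d), F (phasePoint p.1 p.2)
      ∂(volume.prod volume) = ∫ z, F z :=
  (measurePreserving_phaseEquiv d).symm.integral_comp' F

/-! ### The transform of a bounded continuous function -/

theorem stft_eq {d : ℕ} (f : EuclideanSpace ℝ (Fin d) → ℂ) (z : PhaseSpace d) :
    stft gaussian f z = ∫ t, Real.fourierChar (-⟪t, freq z⟫) • (f t * gaussian (t - time z)) := by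
  simp only [stft, conj_gaussian, Real.fourier_eq]

theorem integrable_mul_gaussian_sub {d : ℕ} (f : EuclideanSpace ℝ (Fin d) →ᵇ ℂ)
    (x : EuclideanSpace ℝ (Fin d)) : Integrable (fun t => f t * gaussian (t - x)) := by
  simpa only [conj_gaussian] using integrable_mul_gaussian f x

theorem norm_stft_le {d : ℕ} (f : EuclideanSpace ℝ (Fin d) →ᵇ ℂ) (z : PhaseSpace d) :
    ‖stft gaussian f z‖ ≤ ‖f‖ := by
  rw [stft_eq]
  refine (norm_integral_le_of_norm_le
    (g := fun t => ‖f‖ * ‖gaussian (t - time z)‖) ?_ ?_).trans_eq ?_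
  · exact (integrable_gaussian.comp_sub_right _).norm.const_mul _
  · refine Filter.Eventually.of_forall fun t => ?_
    rw [Circle.norm_smul, norm_mul]
    exact mul_le_mul_of_nonneg_right (f.norm_coe_le_norm t) (norm_nonneg _)
  · rw [integral_const_mul, integral_sub_right_eq_self (fun t => ‖gaussian t‖) (time z),
      integral_norm_gaussian, mul_one]

/-- Moving the translation off the Gaussian leaves a dominating function independent of `z`, which
gives continuity in `z` by dominated convergence. -/
theorem stft_eq_integral_add {d : ℕ} (f : EuclideanSpace ℝ (Fin d) → ℂ) (z : PhaseSpace d) :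
    stft gaussian f z = ∫ t, Real.fourierChar (-⟪t + time z, freq z⟫) •
      (f (t + time z) * gaussian t) := by
  rw [stft_eq, ← integral_add_right_eq_self _ (time z)]
  simp only [add_sub_cancel_right]

theorem continuous_stft {d : ℕ} (f : EuclideanSpace ℝ (Fin d) →ᵇ ℂ) :
    Continuous (stft gaussian f) := by
  have h : stft gaussian f = fun z => ∫ t, Real.fourierChar (-⟪t + time z, freq z⟫) •
      (f (t + time z) * gaussian t) := funext (stft_eq_integral_add f)
  rw [h]
  refine continuous_of_dominated (bound := fun t => ‖f‖ * ‖gaussian t‖) ?_ ?_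
    (integrable_gaussian.norm.const_mul _) ?_
  · intro z
    have := f.continuous
    exact Continuous.aestronglyMeasurable (by fun_prop)
  · intro z
    refine Filter.Eventually.of_forall fun t => ?_
    rw [Circle.norm_smul, norm_mul]
    exact mul_le_mul_of_nonneg_right (f.norm_coe_le_norm _) (norm_nonneg _)
  · refine Filter.Eventually.of_forall fun t => ?_
    have := f.continuous
    fun_prop

/-! ### Wiener norm: integrability and Gaussian superpositions -/

section Wiener

variable {ι : Type*} [Fintype ι]

/-- The point `n / 2` of the half-integer lattice. -/
noncomputable def halfLattice (n : ι → ℤ) : EuclideanSpace ℝ ι :=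
  WithLp.toLp 2 (fun j => (n j : ℝ) / 2)

theorem tent_nonneg (t : EuclideanSpace ℝ ι) : 0 ≤ tent t :=
  Finset.prod_nonneg fun _ _ => le_max_right _ _

theorem tent_le_one (t : EuclideanSpace ℝ ι) : tent t ≤ 1 :=
  Finset.prod_le_one (fun _ _ => le_max_right _ _) fun j _ =>
    max_le (by linarith [abs_nonneg (t j)]) zero_le_one

theorem norm_le_sqrt_card {t : EuclideanSpace ℝ ι} (h : ∀ j, |t j| ≤ 1 / 2) :
    ‖t‖ ≤ √(Fintype.card ι) := by
  rw [EuclideanSpace.norm_eq]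
  refine Real.sqrt_le_sqrt ?_
  have : (Fintype.card ι : ℝ) = ∑ _j : ι, 1 := by simp
  rw [this]
  refine Finset.sum_le_sum fun j _ => ?_
  rw [Real.norm_eq_abs]
  nlinarith [h j, abs_nonneg (t j)]

theorem norm_le_of_tent_ne_zero {t : EuclideanSpace ℝ ι} (h : tent t ≠ 0) :
    ‖t‖ ≤ √(Fintype.card ι) := by
  refine norm_le_sqrt_card fun j => ?_
  by_contra hj
  push Not at hj
  exact h (Finset.prod_eq_zero (Finset.mem_univ j) (max_eq_right (by linarith)))

/-- Rounding `2 t_j` puts each `t_j` within `1/4` of the half-integer lattice, so every factor of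
the tent is at least `1/2`. -/
theorem exists_psi_ge (t : EuclideanSpace ℝ ι) :
    ∃ n : ι → ℤ, (1 / 2) ^ Fintype.card ι ≤ psi n t ∧
      ‖t - halfLattice n‖ ≤ √(Fintype.card ι) := by
  have hj : ∀ j, |t j - (round (2 * t j) : ℝ) / 2| ≤ 1 / 4 := fun j => by
    have := abs_sub_round (2 * t j)
    rw [abs_le] at this ⊢
    constructor <;> linarith [this.1, this.2]
  refine ⟨fun j => round (2 * t j), ?_, ?_⟩
  · rw [psi, tent, ← Finset.card_univ, ← Finset.prod_const]
    refine Finset.prod_le_prod (fun _ _ => by norm_num) fun j _ => le_max_of_le_left ?_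
    have := hj j
    simp only [PiLp.sub_apply]
    linarith
  · refine norm_le_sqrt_card fun j => ?_
    have := hj j
    simp only [halfLattice, PiLp.sub_apply]
    linarith

/-- At every point some `ψₙ` is at least `2^{-m}`, so `|F|` is at most `2^m` times a sum of the
constants `‖F ψₙ‖_∞` on balls about the lattice points, all of equal volume. -/
theorem MemWiener.integrable {F : EuclideanSpace ℝ ι → ℂ} (hF : MemWiener F) :
    Integrable F := by
  refine ⟨hF.continuous.aestronglyMeasurable, ?_⟩
  set R := √(Fintype.card ι)
  set a : (ι → ℤ) → ℝ≥0∞ := fun n => ⨆ t : EuclideanSpace ℝ ι, ‖F t * (psi n t : ℂ)‖ₑ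
  have hle : ∀ t, ‖F t‖ₑ ≤ 2 ^ Fintype.card ι *
      ∑' n, (Metric.closedBall (halfLattice n) R).indicator (fun _ => a n) t := by
    intro t
    obtain ⟨n, hn, hR⟩ := exists_psi_ge t
    have h1 : ‖F t‖ ≤ 2 ^ Fintype.card ι * ‖F t * (psi n t : ℂ)‖ := by
      have hp : 0 ≤ psi n t := le_trans (by positivity) hn
      rw [norm_mul, Complex.norm_real, Real.norm_eq_abs, abs_of_nonneg hp]
      calc ‖F t‖ = 2 ^ Fintype.card ι * (‖F t‖ * (1 / 2) ^ Fintype.card ι) := by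
            rw [mul_comm ‖F t‖, ← mul_assoc, ← mul_pow]; norm_num
        _ ≤ _ := by gcongr
    have h2 : ‖F t‖ₑ ≤ 2 ^ Fintype.card ι * ‖F t * (psi n t : ℂ)‖ₑ := by
      rw [← ofReal_norm, ← ofReal_norm]
      refine (ENNReal.ofReal_le_ofReal h1).trans_eq ?_
      rw [ENNReal.ofReal_mul (by positivity), ENNReal.ofReal_pow (by norm_num)]
      norm_num
    refine h2.trans (mul_le_mul_right ?_ _)
    refine le_trans ?_ (ENNReal.le_tsum n)
    rw [Set.indicator_of_mem (by simpa [dist_eq_norm] using hR)]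
    exact le_iSup (fun t => ‖F t * (psi n t : ℂ)‖ₑ) t
  refine lt_of_le_of_lt (lintegral_mono hle) ?_
  rw [lintegral_const_mul' _ _ (by finiteness),
    lintegral_tsum fun n => (measurable_const.indicator measurableSet_closedBall).aemeasurable]
  have hvol : ∀ n, ∫⁻ t, (Metric.closedBall (halfLattice n) R).indicator (fun _ => a n) t
      = a n * volume (Metric.closedBall (0 : EuclideanSpace ℝ ι) R) := fun n => by
    rw [lintegral_indicator_const measurableSet_closedBall, Measure.addHaar_closedBall_center]
  simp only [hvol]
  rw [ENNReal.tsum_mul_right]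
  exact ENNReal.mul_lt_top (by finiteness)
    (ENNReal.mul_lt_top hF.wienerNorm_lt_top measure_closedBall_lt_top)

theorem pairwise_disjoint_ball_halfLattice :
    Pairwise (Function.onFun Disjoint
      fun n : ι → ℤ => Metric.ball (halfLattice n) (1 / 4 : ℝ)) := by
  intro n m hnm
  refine Metric.ball_disjoint_ball ?_
  obtain ⟨j, hj⟩ := Function.ne_iff.1 hnm
  have h1 : (1 : ℝ) ≤ |(n j : ℝ) - m j| := by
    exact_mod_cast Int.one_le_abs (sub_ne_zero.2 hj)
  have h2 := PiLp.norm_apply_le (halfLattice n - halfLattice m) j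
  rw [dist_eq_norm]
  refine le_trans ?_ h2
  simp only [halfLattice, PiLp.sub_apply, Real.norm_eq_abs]
  rw [← sub_div, abs_div, abs_two]
  linarith

theorem lintegral_exp_neg_mul_sq_lt_top {a : ℝ} (ha : 0 < a) :
    ∫⁻ u : EuclideanSpace ℝ ι, ENNReal.ofReal (Real.exp (-a * ‖u‖ ^ 2)) < ∞ := by
  have h := GaussianFourier.integrable_cexp_neg_mul_sq_norm_add
    (V := EuclideanSpace ℝ ι) (b := (a : ℂ)) (by simpa using ha) 0 0
  refine lt_of_eq_of_lt (lintegral_congr fun u => ?_) h.2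
  rw [← ofReal_norm, Complex.norm_exp]
  congr 2
  simp [← Complex.ofReal_pow]

/-- The balls are disjoint, so the lattice sum is at most one full Gaussian integral, uniformly in
the centre `y`. -/
theorem tsum_setLIntegral_ball_le {a : ℝ} (y : EuclideanSpace ℝ ι) :
    ∑' n : ι → ℤ, ∫⁻ u in Metric.ball (halfLattice n) (1 / 4 : ℝ),
        ENNReal.ofReal (Real.exp (-a * ‖u - y‖ ^ 2)) ≤
      ∫⁻ u : EuclideanSpace ℝ ι, ENNReal.ofReal (Real.exp (-a * ‖u‖ ^ 2)) := by
  rw [← lintegral_iUnion (fun _ => measurableSet_ball) pairwise_disjoint_ball_halfLattice]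
  refine (setLIntegral_le_lintegral _ _).trans_eq ?_
  exact lintegral_sub_right_eq_self
    (fun u : EuclideanSpace ℝ ι => ENNReal.ofReal (Real.exp (-a * ‖u‖ ^ 2))) y

/-- A point value on the support of `ψₙ` is traded for an integral over a ball about `n/2`: there
`u` stays within a fixed distance of `t`, and `‖u - y‖² ≤ 2‖u - t‖² + 2‖t - y‖²` costs half the
exponent and a constant factor. -/
theorem exp_mul_volume_ball_le {a : ℝ} (ha : 0 < a) {n : ι → ℤ} {t : EuclideanSpace ℝ ι}
    (ht : psi n t ≠ 0) (y : EuclideanSpace ℝ ι) :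
    ENNReal.ofReal (Real.exp (-a * ‖t - y‖ ^ 2)) *
        volume (Metric.ball (0 : EuclideanSpace ℝ ι) (1 / 4)) ≤
      ENNReal.ofReal (Real.exp (a * (√(Fintype.card ι) + 1) ^ 2)) *
        ∫⁻ u in Metric.ball (halfLattice n) (1 / 4 : ℝ),
          ENNReal.ofReal (Real.exp (-(a / 2) * ‖u - y‖ ^ 2)) := by
  rw [← Measure.addHaar_ball_center volume (halfLattice n), ← setLIntegral_const,
    ← lintegral_const_mul' _ _ ENNReal.ofReal_ne_top]
  refine setLIntegral_mono' measurableSet_ball fun u hu => ?_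
  rw [← ENNReal.ofReal_mul (Real.exp_nonneg _), ← Real.exp_add]
  refine ENNReal.ofReal_le_ofReal (Real.exp_le_exp.2 ?_)
  have h1 : ‖t - halfLattice n‖ ≤ √(Fintype.card ι) := norm_le_of_tent_ne_zero ht
  have h2 : ‖u - halfLattice n‖ ≤ 1 := by
    rw [← dist_eq_norm]
    linarith [Metric.mem_ball.1 hu]
  have h3 : ‖u - t‖ ≤ √(Fintype.card ι) + 1 := by
    have := norm_sub_le (u - halfLattice n) (t - halfLattice n)
    rw [sub_sub_sub_cancel_right] at this
    linarith
  have h4 : ‖u - y‖ ≤ ‖u - t‖ + ‖t - y‖ := norm_sub_le_norm_sub_add_norm_sub _ _ _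
  have h5 : ‖u - y‖ ^ 2 ≤ 2 * ‖u - t‖ ^ 2 + 2 * ‖t - y‖ ^ 2 := by
    nlinarith [sq_nonneg (‖u - t‖ - ‖t - y‖), norm_nonneg (u - y), norm_nonneg (u - t),
      norm_nonneg (t - y)]
  have h6 : ‖u - t‖ ^ 2 ≤ (√(Fintype.card ι) + 1) ^ 2 := by
    gcongr
  nlinarith [mul_le_mul_of_nonneg_left h5 ha.le, mul_le_mul_of_nonneg_left h6 ha.le]

/-- A function dominated by a superposition of translates of a Gaussian with integrable weight has
finite Wiener norm. -/
theorem wienerNorm_lt_top_of_le_lintegral {Ω : Type*} [MeasurableSpace Ω] {μ : Measure Ω}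
    {F : Ω → ℝ≥0∞} (hF : Measurable F) (hFi : ∫⁻ w, F w ∂μ < ∞)
    {p : Ω → EuclideanSpace ℝ ι} (hp : Measurable p) {C : ℝ≥0∞} (hC : C ≠ ∞) {a : ℝ} (ha : 0 < a)
    {h : EuclideanSpace ℝ ι → ℂ}
    (hh : ∀ t, ‖h t‖ₑ ≤ C * ∫⁻ w, F w * ENNReal.ofReal (Real.exp (-a * ‖t - p w‖ ^ 2)) ∂μ) :
    wienerNorm h < ∞ := by
  set v := volume (Metric.ball (0 : EuclideanSpace ℝ ι) (1 / 4))
  have hv : v ≠ 0 := (Metric.measure_ball_pos _ _ (by norm_num)).ne'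
  set D := ENNReal.ofReal (Real.exp (a * (√(Fintype.card ι) + 1) ^ 2))
  set k : (ι → ℤ) → EuclideanSpace ℝ ι → ℝ≥0∞ := fun n y =>
    ∫⁻ u in Metric.ball (halfLattice n) (1 / 4 : ℝ),
      ENNReal.ofReal (Real.exp (-(a / 2) * ‖u - y‖ ^ 2))
  have hk : ∀ n, Measurable (k n) := fun n => by
    have : Measurable (fun q : EuclideanSpace ℝ ι × EuclideanSpace ℝ ι =>
      ENNReal.ofReal (Real.exp (-(a / 2) * ‖q.2 - q.1‖ ^ 2))) := by fun_prop
    exact this.lintegral_prod_right'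
  have hn : ∀ n, (⨆ t, ‖h t * (psi n t : ℂ)‖ₑ) * v ≤ C * (D * ∫⁻ w, F w * k n (p w) ∂μ) := by
    intro n
    rw [ENNReal.iSup_mul]
    refine iSup_le fun t => ?_
    by_cases ht : psi n t = 0
    · simp [ht]
    have h1 : ‖h t * (psi n t : ℂ)‖ₑ ≤ ‖h t‖ₑ := by
      rw [← ofReal_norm, ← ofReal_norm, norm_mul, Complex.norm_real, Real.norm_eq_abs,
        psi, abs_of_nonneg (tent_nonneg _)]
      exact ENNReal.ofReal_le_ofReal
        (mul_le_of_le_one_right (norm_nonneg _) (tent_le_one _))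
    refine (mul_le_mul_left (h1.trans (hh t)) v).trans ?_
    rw [mul_assoc]
    refine mul_le_mul_right ?_ C
    rw [← lintegral_mul_const'' v (by fun_prop), ← lintegral_const_mul' D _ ENNReal.ofReal_ne_top]
    refine lintegral_mono fun w => ?_
    calc F w * ENNReal.ofReal (Real.exp (-a * ‖t - p w‖ ^ 2)) * v
        = F w * (ENNReal.ofReal (Real.exp (-a * ‖t - p w‖ ^ 2)) * v) := mul_assoc _ _ _
      _ ≤ F w * (D * k n (p w)) := mul_le_mul_right (exp_mul_volume_ball_le ha ht _) _
      _ = D * (F w * k n (p w)) := mul_left_comm _ _ _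
  have hsum : wienerNorm h * v < ∞ := by
    rw [wienerNorm, ← ENNReal.tsum_mul_right]
    refine (ENNReal.tsum_le_tsum hn).trans_lt ?_
    have hm : ∀ n, AEMeasurable (fun w => F w * k n (p w)) μ := fun n =>
      (hF.mul ((hk n).comp hp)).aemeasurable
    rw [ENNReal.tsum_mul_left, ENNReal.tsum_mul_left, ← lintegral_tsum hm]
    simp only [ENNReal.tsum_mul_left]
    refine ENNReal.mul_lt_top hC.lt_top (ENNReal.mul_lt_top ENNReal.ofReal_lt_top ?_)
    -- After exchanging sum and integral, the sum over `n` is bounded independently of `p w`,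
    -- leaving only the total mass of `F`.
    refine (lintegral_mono fun w => mul_le_mul_right (tsum_setLIntegral_ball_le (p w)) _).trans_lt ?_
    rw [lintegral_mul_const _ hF]
    exact ENNReal.mul_lt_top hFi (lintegral_exp_neg_mul_sq_lt_top (by linarith))
  exact lt_of_not_ge fun htop => by
    rw [top_le_iff.1 htop, ENNReal.top_mul hv] at hsum
    exact lt_irrefl _ hsum

end Wiener

/-! ### Inversion and reproducing formulas -/

/-- For almost every `x`, Fourier inversion recovers `f(t) g₀(t - x)` from `V f(x, ·)`; multiply by
`h(t - x)` and integrate over `x`. -/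
theorem mul_integral_eq_integral_stft {d : ℕ} {f : EuclideanSpace ℝ (Fin d) →ᵇ ℂ}
    (hf : Integrable (stft gaussian f)) {h : EuclideanSpace ℝ (Fin d) → ℂ} (hc : Continuous h)
    (hb : ∀ t, ‖h t‖ ≤ 1) (t : EuclideanSpace ℝ (Fin d)) :
    f t * ∫ y, gaussian y * h y =
      ∫ w, stft gaussian f w * (Real.fourierChar ⟪t, freq w⟫ • h (t - time w)) := by
  have hI := integrable_comp_phasePoint hf
  have hG : Integrable (fun p : EuclideanSpace ℝ (Fin d) × EuclideanSpace ℝ (Fin d) =>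
      stft gaussian f (phasePoint p.1 p.2) * (Real.fourierChar ⟪t, p.2⟫ • h (t - p.1)))
      (volume.prod volume) := by
    refine hI.mul_bdd (c := 1) (Continuous.aestronglyMeasurable (by fun_prop))
      (Filter.Eventually.of_forall fun p => ?_)
    rw [Circle.norm_smul]
    exact hb _
  rw [← integral_comp_phasePoint]
  simp only [time_phasePoint, freq_phasePoint]
  rw [integral_prod _ hG, ← integral_const_mul,
    ← integral_sub_left_eq_self (fun y => f t * (gaussian y * h y)) _ t]
  refine integral_congr_ae ?_
  -- By Fubini, almost every slice `V f(x, ·)` is integrable, as Fourier inversion requires.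
  filter_upwards [hI.prod_right_ae] with x hx
  have hfc := f.continuous
  have hinv := congrFun (Continuous.fourierInv_fourier_eq (by fun_prop)
    (integrable_mul_gaussian_sub f x) (by simpa only [stft, conj_gaussian] using! hx)) t
  rw [Real.fourierInv_eq] at hinv
  rw [← mul_assoc, ← hinv, ← integral_mul_const]
  refine integral_congr_ae (Filter.Eventually.of_forall fun ω => ?_)
  simp only [stft, conj_gaussian, time_phasePoint, freq_phasePoint, Circle.smul_def, smul_eq_mul,
    real_inner_comm]
  ring

theorem eq_integral_stft {d : ℕ} {f : EuclideanSpace ℝ (Fin d) →ᵇ ℂ}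
    (hf : Integrable (stft gaussian f)) (t : EuclideanSpace ℝ (Fin d)) :
    f t = ∫ w, stft gaussian f w * (Real.fourierChar ⟪t, freq w⟫ : ℂ) := by
  have h := mul_integral_eq_integral_stft hf (h := fun _ => 1) continuous_const (by simp) t
  simpa [integral_gaussian, Circle.smul_def] using h

theorem norm_apply_le_integral_norm_stft {d : ℕ} {f : EuclideanSpace ℝ (Fin d) →ᵇ ℂ}
    (hf : Integrable (stft gaussian f)) (t : EuclideanSpace ℝ (Fin d)) :
    ‖f t‖ ≤ ∫ w, ‖stft gaussian f w‖ := by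
  rw [eq_integral_stft hf t]
  refine (norm_integral_le_integral_norm _).trans_eq ?_
  simp [Circle.norm_coe]

theorem integral_mul_integral_swap {d : ℕ} {F : PhaseSpace d → ℂ} (hF : Integrable F)
    {u : EuclideanSpace ℝ (Fin d) → ℂ} (hu : Integrable u)
    {Φ : EuclideanSpace ℝ (Fin d) → PhaseSpace d → ℂ} (hΦ : Continuous (Function.uncurry Φ))
    (hb : ∀ t w, ‖Φ t w‖ ≤ 1) :
    ∫ t, u t * ∫ w, F w * Φ t w = ∫ w, F w * ∫ t, u t * Φ t w := by
  have h : Integrable (fun p : EuclideanSpace ℝ (Fin d) × PhaseSpace d =>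
      u p.1 * F p.2 * Φ p.1 p.2) (volume.prod volume) :=
    (hu.mul_prod hF).mul_bdd (c := 1) hΦ.aestronglyMeasurable
      (Filter.Eventually.of_forall fun p => hb _ _)
  simp only [← integral_const_mul]
  rw [← integral_integral_swap (f := fun t w => F w * (u t * Φ t w))]
  · refine integral_congr_ae (Filter.Eventually.of_forall fun t => ?_)
    refine integral_congr_ae (Filter.Eventually.of_forall fun w => ?_)
    simp only
    ring
  · refine h.congr (Filter.Eventually.of_forall fun p => ?_)
    simp only [Function.uncurry]
    ring

/-- A Gaussian bound for the reproducing kernel of the Gaussian short-time Fourier transform. -/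
theorem norm_integral_gaussian_kernel_le {d : ℕ} (z w : PhaseSpace d) :
    ‖∫ t, (Real.fourierChar (-⟪t, freq z⟫) • gaussian (t - time z)) *
        (Real.fourierChar ⟪t, freq w⟫ • gaussian (t - time w))‖ ≤
      Real.exp (-(Real.pi / 2) * ‖z - w‖ ^ 2) := by
  -- Centred at the midpoint `m` of the two times, the product of the Gaussians is `c e^{-2π‖t‖²}`
  -- by the parallelogram law; what remains is the Fourier transform of that Gaussian at the
  -- frequency difference.
  set m : EuclideanSpace ℝ (Fin d) := (1 / 2 : ℝ) • (time z + time w)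
  set c : ℝ := Real.exp (-(Real.pi / 2) * ‖time z - time w‖ ^ 2)
  have hpar : ∀ t : EuclideanSpace ℝ (Fin d), ‖t + m - time z‖ ^ 2 + ‖t + m - time w‖ ^ 2
      = 2 * ‖t‖ ^ 2 + 1 / 2 * ‖time z - time w‖ ^ 2 := by
    intro t
    have h := parallelogram_law_with_norm ℝ t ((1 / 2 : ℝ) • (time z - time w))
    have e1 : t + m - time w = t + (1 / 2 : ℝ) • (time z - time w) := by
      simp only [m]; module
    have e2 : t + m - time z = t - (1 / 2 : ℝ) • (time z - time w) := by
      simp only [m]; module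
    have e3 : ‖(1 / 2 : ℝ) • (time z - time w)‖ = 1 / 2 * ‖time z - time w‖ := by
      rw [norm_smul]; norm_num
    rw [e1, e2]
    rw [e3] at h
    nlinarith
  have hint : ∫ t, (Real.fourierChar (-⟪t, freq z⟫) • gaussian (t - time z)) *
        (Real.fourierChar ⟪t, freq w⟫ • gaussian (t - time w)) =
      (Real.fourierChar (-⟪m, freq z - freq w⟫) : ℂ) * c *
        𝓕 (fun t : EuclideanSpace ℝ (Fin d) =>
          Complex.exp (-((2 * Real.pi : ℝ) : ℂ) * (‖t‖ : ℂ) ^ 2)) (freq z - freq w) := by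
    rw [Real.fourier_eq, ← integral_const_mul, ← integral_add_right_eq_self _ m]
    refine integral_congr_ae (Filter.Eventually.of_forall fun t => ?_)
    have hg : gaussian (t + m - time z) * gaussian (t + m - time w) =
        c * Complex.exp (-((2 * Real.pi : ℝ) : ℂ) * (‖t‖ : ℂ) ^ 2) := by
      rw [gaussian_eq_ofReal, gaussian_eq_ofReal, ← Complex.ofReal_mul, ← Real.exp_add,
        ← mul_add, hpar, ← Complex.ofReal_pow, ← Complex.ofReal_neg, ← Complex.ofReal_mul,
        ← Complex.ofReal_exp, ← Complex.ofReal_mul, ← Real.exp_add]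
      congr 2
      ring
    have hch : (Real.fourierChar (-⟪t + m, freq z⟫) : ℂ) * Real.fourierChar ⟪t + m, freq w⟫ =
        Real.fourierChar (-⟪m, freq z - freq w⟫) * Real.fourierChar (-⟪t, freq z - freq w⟫) := by
      simp only [← Circle.coe_mul, ← AddChar.map_add_eq_mul]
      congr 2
      simp only [inner_add_left, inner_sub_right]
      ring
    simp only [Circle.smul_def, smul_eq_mul]
    calc _ = ((Real.fourierChar (-⟪t + m, freq z⟫) : ℂ) * Real.fourierChar ⟪t + m, freq w⟫) *
          (gaussian (t + m - time z) * gaussian (t + m - time w)) := by ring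
      _ = _ := by rw [hg, hch]; ring
  rw [hint, fourier_gaussian_innerProductSpace (by simpa using Real.pi_pos), norm_mul, norm_mul,
    norm_mul, Circle.norm_coe, one_mul, Complex.norm_real, Real.norm_eq_abs,
    abs_of_nonneg (Real.exp_nonneg _)]
  have hpi := Real.pi_pos
  -- The factor `(1/2)^{d/2}` is simply discarded.
  have h1 : ‖((Real.pi : ℂ) / ((2 * Real.pi : ℝ) : ℂ)) ^
      (Module.finrank ℝ (EuclideanSpace ℝ (Fin d)) / 2 : ℂ)‖ ≤ 1 := by
    have e : (Real.pi : ℂ) / ((2 * Real.pi : ℝ) : ℂ) = ((1 / 2 : ℝ) : ℂ) := by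
      rw [← Complex.ofReal_div]
      congr 1
      field_simp
    rw [e, Complex.norm_cpow_eq_rpow_re_of_pos (by norm_num)]
    refine Real.rpow_le_one (by norm_num) (by norm_num) ?_
    simp
    positivity
  have h2 : ‖Complex.exp (-(Real.pi : ℂ) ^ 2 * (‖freq z - freq w‖ : ℂ) ^ 2 /
      ((2 * Real.pi : ℝ) : ℂ))‖ = Real.exp (-(Real.pi / 2) * ‖freq z - freq w‖ ^ 2) := by
    have e : -(Real.pi : ℂ) ^ 2 * (‖freq z - freq w‖ : ℂ) ^ 2 / ((2 * Real.pi : ℝ) : ℂ) =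
        ((-(Real.pi / 2) * ‖freq z - freq w‖ ^ 2 : ℝ) : ℂ) := by
      push_cast
      field_simp
    rw [e, Complex.norm_exp, Complex.ofReal_re]
  rw [h2, norm_sq_eq_time_add_freq, time_sub, freq_sub, mul_add, Real.exp_add]
  refine mul_le_mul_of_nonneg_left ?_ (Real.exp_nonneg _)
  exact mul_le_of_le_one_left (Real.exp_nonneg _) h1

/-- Inserting the inversion formula with weight `g₀` into the definition of `V f` reproduces `V f`
through a kernel with Gaussian decay, so it is a superposition of translated Gaussians with weight
`|V f|`. -/
theorem memWiener_stft {d : ℕ} {f : EuclideanSpace ℝ (Fin d) →ᵇ ℂ}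
    (hf : Integrable (stft gaussian f)) : MemWiener (stft gaussian f) := by
  refine ⟨continuous_stft f, ⟨‖f‖, norm_stft_le f⟩, ?_⟩
  set c : ℂ := ∫ y : EuclideanSpace ℝ (Fin d), gaussian y * gaussian y
  have hc : c ≠ 0 := integral_gaussian_mul_gaussian_ne_zero
  have key : ∀ z, stft gaussian f z * c = ∫ w, stft gaussian f w *
      ∫ t, (Real.fourierChar (-⟪t, freq z⟫) • gaussian (t - time z)) *
        (Real.fourierChar ⟪t, freq w⟫ • gaussian (t - time w)) := by
    intro z
    rw [← integral_mul_integral_swap hf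
      (Φ := fun t w => Real.fourierChar ⟪t, freq w⟫ • gaussian (t - time w))
      ((Real.fourierIntegral_convergent_iff _).2 (integrable_gaussian.comp_sub_right _))
      (by unfold Function.uncurry; fun_prop)
      (fun t w => by rw [Circle.norm_smul]; exact norm_gaussian_le_one _)]
    rw [stft_eq, ← integral_mul_const]
    refine integral_congr_ae (Filter.Eventually.of_forall fun t => ?_)
    simp only
    rw [← mul_integral_eq_integral_stft hf continuous_gaussian norm_gaussian_le_one t]
    simp only [Circle.smul_def, smul_eq_mul]
    ring
  refine wienerNorm_lt_top_of_le_lintegral (μ := volume) (F := fun w => ‖stft gaussian f w‖ₑ)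
    (p := id) (C := ‖c⁻¹‖ₑ) (a := Real.pi / 2) (continuous_stft f).enorm.measurable hf.2
    measurable_id enorm_ne_top (by positivity) fun z => ?_
  have hz : stft gaussian f z = c⁻¹ * (stft gaussian f z * c) := by field_simp
  rw [hz, enorm_mul, key]
  refine mul_le_mul_right ((enorm_integral_le_lintegral_enorm _).trans
    (lintegral_mono fun w => ?_)) _
  rw [enorm_mul]
  refine mul_le_mul_right ?_ _
  rw [← ofReal_norm]
  exact ENNReal.ofReal_le_ofReal (norm_integral_gaussian_kernel_le z w)

/-- The same superposition argument, applied to the inversion formula itself: the Gaussians are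
centred at the time components. -/
theorem memWiener_of_integrable_stft {d : ℕ} {f : EuclideanSpace ℝ (Fin d) →ᵇ ℂ}
    (hf : Integrable (stft gaussian f)) : MemWiener f := by
  refine ⟨f.continuous, ⟨‖f‖, f.norm_coe_le_norm⟩, ?_⟩
  set c : ℂ := ∫ y : EuclideanSpace ℝ (Fin d), gaussian y * gaussian y
  have hc : c ≠ 0 := integral_gaussian_mul_gaussian_ne_zero
  refine wienerNorm_lt_top_of_le_lintegral (μ := volume) (F := fun w => ‖stft gaussian f w‖ₑ)
    (p := time) (C := ‖c⁻¹‖ₑ) (a := Real.pi) (continuous_stft f).enorm.measurable hf.2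
    continuous_time.measurable enorm_ne_top Real.pi_pos fun t => ?_
  have hz : f t = c⁻¹ * (f t * c) := by field_simp
  rw [hz, enorm_mul, mul_integral_eq_integral_stft hf continuous_gaussian norm_gaussian_le_one]
  refine mul_le_mul_right ((enorm_integral_le_lintegral_enorm _).trans
    (lintegral_mono fun w => ?_)) _
  rw [enorm_mul]
  refine mul_le_mul_right ?_ _
  rw [← ofReal_norm, Circle.norm_smul, norm_gaussian]

theorem integrable_stft_integrand {d : ℕ} (f : EuclideanSpace ℝ (Fin d) →ᵇ ℂ)
    (z : PhaseSpace d) :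
    Integrable fun t => Real.fourierChar (-⟪t, freq z⟫) • (f t * gaussian (t - time z)) :=
  (Real.fourierIntegral_convergent_iff _).2 (integrable_mul_gaussian_sub f _)

theorem stft_add {d : ℕ} (f g : EuclideanSpace ℝ (Fin d) →ᵇ ℂ) (z : PhaseSpace d) :
    stft gaussian ⇑(f + g) z = stft gaussian f z + stft gaussian g z := by
  simp only [stft_eq, BoundedContinuousFunction.coe_add, Pi.add_apply, add_mul, smul_add]
  exact integral_add (integrable_stft_integrand f z) (integrable_stft_integrand g z)

theorem stft_sub {d : ℕ} (f g : EuclideanSpace ℝ (Fin d) →ᵇ ℂ) (z : PhaseSpace d) :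
    stft gaussian ⇑(f - g) z = stft gaussian f z - stft gaussian g z := by
  simp only [stft_eq, BoundedContinuousFunction.coe_sub, Pi.sub_apply, sub_mul, smul_sub]
  exact integral_sub (integrable_stft_integrand f z) (integrable_stft_integrand g z)

theorem stft_smul {d : ℕ} (c : ℂ) (f : EuclideanSpace ℝ (Fin d) →ᵇ ℂ) (z : PhaseSpace d) :
    stft gaussian ⇑(c • f) z = c * stft gaussian f z := by
  simp only [stft_eq, BoundedContinuousFunction.coe_smul, smul_eq_mul, ← integral_const_mul]
  refine integral_congr_ae (Filter.Eventually.of_forall fun t => ?_)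
  simp only [Circle.smul_def, smul_eq_mul]
  ring

/-! Short-time Fourier transform of time-frequency shifts, products and Fourier transforms. -/

/-- The time-frequency shift `t ↦ e^{2πi ω·t} f(t - x)` of a bounded continuous function. -/
noncomputable def timeFreqShift {d : ℕ} (x ω : EuclideanSpace ℝ (Fin d))
    (f : EuclideanSpace ℝ (Fin d) →ᵇ ℂ) : EuclideanSpace ℝ (Fin d) →ᵇ ℂ :=
  BoundedContinuousFunction.ofNormedAddCommGroup
    (fun t => (Real.fourierChar ⟪ω, t⟫ : ℂ) * f (t - x))
    (by have := f.continuous; fun_prop) ‖f‖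
    (fun t => by
      rw [norm_mul, Circle.norm_coe, one_mul]
      exact f.norm_coe_le_norm _)

@[simp] theorem timeFreqShift_apply {d : ℕ} (x ω : EuclideanSpace ℝ (Fin d))
    (f : EuclideanSpace ℝ (Fin d) →ᵇ ℂ) (t : EuclideanSpace ℝ (Fin d)) :
    timeFreqShift x ω f t = (Real.fourierChar ⟪ω, t⟫ : ℂ) * f (t - x) := rfl

theorem stft_timeFreqShift {d : ℕ} (x ω : EuclideanSpace ℝ (Fin d))
    (f : EuclideanSpace ℝ (Fin d) →ᵇ ℂ) (z : PhaseSpace d) :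
    stft gaussian (timeFreqShift x ω f) z =
      (Real.fourierChar ⟪x, ω - freq z⟫ : ℂ) * stft gaussian f (z - phasePoint x ω) := by
  rw [stft_eq, stft_eq, ← integral_const_mul, ← integral_add_right_eq_self _ x]
  refine integral_congr_ae (Filter.Eventually.of_forall fun t => ?_)
  have hch : (Real.fourierChar (-⟪t + x, freq z⟫) : ℂ) * Real.fourierChar ⟪ω, t + x⟫ =
      Real.fourierChar ⟪x, ω - freq z⟫ * Real.fourierChar (-⟪t, freq z - ω⟫) := by
    simp only [← Circle.coe_mul, ← AddChar.map_add_eq_mul]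
    congr 2
    simp only [inner_add_left, inner_add_right, inner_sub_right, real_inner_comm ω]
    ring
  have hts : t + x - time z = t - (time z - x) := by abel
  simp only [timeFreqShift_apply, freq_sub, time_sub, time_phasePoint, freq_phasePoint,
    Circle.smul_def, smul_eq_mul, add_sub_cancel_right, hts]
  rw [← mul_assoc, ← mul_assoc, hch]
  ring

theorem norm_stft_timeFreqShift {d : ℕ} (x ω : EuclideanSpace ℝ (Fin d))
    (f : EuclideanSpace ℝ (Fin d) →ᵇ ℂ) (z : PhaseSpace d) :
    ‖stft gaussian (timeFreqShift x ω f) z‖ = ‖stft gaussian f (z - phasePoint x ω)‖ := by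
  rw [stft_timeFreqShift, norm_mul, Circle.norm_coe, one_mul]

/-- Expand `f` into pure exponentials by the inversion formula with weight one; multiplying `g` by
an exponential translates `V g` in frequency only. -/
theorem stft_mul {d : ℕ} {f : EuclideanSpace ℝ (Fin d) →ᵇ ℂ} (hf : Integrable (stft gaussian f))
    (g : EuclideanSpace ℝ (Fin d) →ᵇ ℂ) (z : PhaseSpace d) :
    stft gaussian ⇑(f * g) z =
      ∫ w, stft gaussian f w * stft gaussian g (z - phasePoint 0 (freq w)) := by
  have h := integral_mul_integral_swap hf (integrable_stft_integrand g z)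
    (Φ := fun t w => (Real.fourierChar ⟪t, freq w⟫ : ℂ)) (by unfold Function.uncurry; fun_prop)
    (fun t w => (Circle.norm_coe _).le)
  simp only [← eq_integral_stft hf] at h
  calc stft gaussian ⇑(f * g) z
      = ∫ t, Real.fourierChar (-⟪t, freq z⟫) • (g t * gaussian (t - time z)) * f t := by
        rw [stft_eq]
        refine integral_congr_ae (Filter.Eventually.of_forall fun t => ?_)
        simp only [BoundedContinuousFunction.coe_mul, Pi.mul_apply, Circle.smul_def, smul_eq_mul]
        ring
    _ = _ := h
    _ = _ := by
        refine integral_congr_ae (Filter.Eventually.of_forall fun w => ?_)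
        simp only [stft_eq g]
        congr 1
        refine integral_congr_ae (Filter.Eventually.of_forall fun t => ?_)
        have hch : (Real.fourierChar (-⟪t, freq z⟫) : ℂ) * Real.fourierChar ⟪t, freq w⟫ =
            Real.fourierChar (-⟪t, freq z - freq w⟫) := by
          simp only [← Circle.coe_mul, ← AddChar.map_add_eq_mul]
          congr 2
          simp only [inner_sub_right]
          ring
        simp only [freq_sub, time_sub, time_phasePoint, freq_phasePoint, sub_zero,
          Circle.smul_def, smul_eq_mul, ← hch]
        ring

/-- Tonelli and translation invariance, as in Young's inequality for L¹. -/
theorem lintegral_stft_mul_le {d : ℕ} {f : EuclideanSpace ℝ (Fin d) →ᵇ ℂ}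
    (hf : Integrable (stft gaussian f)) (g : EuclideanSpace ℝ (Fin d) →ᵇ ℂ) :
    ∫⁻ z, ‖stft gaussian ⇑(f * g) z‖ₑ ≤
      (∫⁻ z, ‖stft gaussian f z‖ₑ) * ∫⁻ z, ‖stft gaussian g z‖ₑ := by
  have hcf := continuous_stft f
  have hcg := continuous_stft g
  have hcp : Continuous fun w : PhaseSpace d => phasePoint 0 (freq w) :=
    continuous_phasePoint.comp (continuous_const.prodMk continuous_freq)
  calc ∫⁻ z, ‖stft gaussian ⇑(f * g) z‖ₑ
      ≤ ∫⁻ z, ∫⁻ w, ‖stft gaussian f w‖ₑ * ‖stft gaussian g (z - phasePoint 0 (freq w))‖ₑ := by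
        refine lintegral_mono fun z => ?_
        rw [stft_mul hf]
        refine (enorm_integral_le_lintegral_enorm _).trans_eq ?_
        simp only [enorm_mul]
    _ = ∫⁻ w, ∫⁻ z, ‖stft gaussian f w‖ₑ * ‖stft gaussian g (z - phasePoint 0 (freq w))‖ₑ := by
        refine lintegral_lintegral_swap (Measurable.aemeasurable ?_)
        unfold Function.uncurry
        exact (by fun_prop : Continuous fun p : PhaseSpace d × PhaseSpace d =>
          stft gaussian f p.2).enorm.measurable.mul
          (hcg.comp (continuous_fst.sub (hcp.comp continuous_snd))).enorm.measurable
    _ = _ := by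
        rw [← lintegral_mul_const _ hcf.enorm.measurable]
        refine lintegral_congr fun w => ?_
        rw [lintegral_const_mul' _ _ enorm_ne_top,
          lintegral_sub_right_eq_self (fun z => ‖stft gaussian g z‖ₑ)]

/-- The Fourier transform of an integrable function, as a bounded continuous function. -/
noncomputable def fourierBCF {d : ℕ} (f : EuclideanSpace ℝ (Fin d) → ℂ) (hf : Integrable f) :
    EuclideanSpace ℝ (Fin d) →ᵇ ℂ :=
  BoundedContinuousFunction.ofNormedAddCommGroup (𝓕 f)
    (VectorFourier.fourierIntegral_continuous Real.continuous_fourierChar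
      (L := innerₗ (EuclideanSpace ℝ (Fin d))) continuous_inner hf) (∫ t, ‖f t‖)
    (VectorFourier.norm_fourierIntegral_le_integral_norm _ _ _ _)

@[simp] theorem coe_fourierBCF {d : ℕ} (f : EuclideanSpace ℝ (Fin d) → ℂ) (hf : Integrable f) :
    ⇑(fourierBCF f hf) = 𝓕 f := rfl

/-- The rotation `(x, ω) ↦ (-ω, x)` of phase space. -/
noncomputable def phaseRotation (d : ℕ) : PhaseSpace d ≃ₗᵢ[ℝ] PhaseSpace d where
  toFun z := phasePoint (-freq z) (time z)
  invFun z := phasePoint (freq z) (-time z)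
  map_add' z w := by
    ext (i | i)
    · simp [phasePoint, freq, time]; ring
    · simp [phasePoint, freq, time]
  map_smul' c z := by
    ext (i | i) <;> simp [phasePoint, freq, time]
  left_inv z := by simp [phasePoint_time_freq]
  right_inv z := by simp [phasePoint_time_freq]
  norm_map' z := by
    rw [← sq_eq_sq₀ (norm_nonneg _) (norm_nonneg _), norm_sq_eq_time_add_freq,
      norm_sq_eq_time_add_freq z]
    simp [add_comm]

theorem phaseRotation_apply {d : ℕ} (z : PhaseSpace d) :
    phaseRotation d z = phasePoint (-freq z) (time z) := rfl

theorem fourier_modulated_gaussian {d : ℕ} (x ω s : EuclideanSpace ℝ (Fin d)) :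
    𝓕 (fun t => Real.fourierChar (-⟪t, ω⟫) • gaussian (t - x)) s =
      Real.fourierChar (-⟪x, s + ω⟫) • gaussian (s + ω) := by
  have h := congrFun (fourier_gaussian (d := d)) (s + ω)
  rw [← h, Real.fourier_eq, Real.fourier_eq, ← integral_add_right_eq_self _ x,
    Circle.smul_def, smul_eq_mul, ← integral_const_mul]
  refine integral_congr_ae (Filter.Eventually.of_forall fun t => ?_)
  have hch : (Real.fourierChar (-⟪t + x, s⟫) : ℂ) * Real.fourierChar (-⟪t + x, ω⟫) =
      Real.fourierChar (-⟪x, s + ω⟫) * Real.fourierChar (-⟪t, s + ω⟫) := by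
    simp only [← Circle.coe_mul, ← AddChar.map_add_eq_mul]
    congr 2
    simp only [inner_add_left, inner_add_right]
    ring
  simp only [Circle.smul_def, smul_eq_mul, add_sub_cancel_right]
  rw [← mul_assoc, hch, mul_assoc]

/-- The multiplication formula `∫ f̂ u = ∫ f û` moves the transform onto the modulated, translated
Gaussian, which is again of that kind because `g₀` is its own Fourier transform. -/
theorem stft_fourier {d : ℕ} {f : EuclideanSpace ℝ (Fin d) → ℂ} (hf : Integrable f)
    (z : PhaseSpace d) :
    stft gaussian (𝓕 f) z =
      (Real.fourierChar (-⟪time z, freq z⟫) : ℂ) * stft gaussian f (phaseRotation d z) := by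
  have hu : Integrable fun t => Real.fourierChar (-⟪t, freq z⟫) • gaussian (t - time z) :=
    (Real.fourierIntegral_convergent_iff _).2 (integrable_gaussian.comp_sub_right _)
  have h := VectorFourier.integral_fourierIntegral_smul_eq_flip (μ := volume) (ν := volume)
    (L := innerₗ (EuclideanSpace ℝ (Fin d))) Real.continuous_fourierChar continuous_inner hf hu
  rw [flip_innerₗ] at h
  calc stft gaussian (𝓕 f) z
      = ∫ t, 𝓕 f t • (Real.fourierChar (-⟪t, freq z⟫) • gaussian (t - time z)) := by
        rw [stft_eq]
        refine integral_congr_ae (Filter.Eventually.of_forall fun t => ?_)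
        simp only [Circle.smul_def, smul_eq_mul]
        ring
    _ = ∫ s, f s • 𝓕 (fun t => Real.fourierChar (-⟪t, freq z⟫) • gaussian (t - time z)) s := h
    _ = _ := by
        rw [stft_eq, ← integral_const_mul]
        refine integral_congr_ae (Filter.Eventually.of_forall fun s => ?_)
        have hch : (Real.fourierChar (-⟪time z, s + freq z⟫) : ℂ) =
            Real.fourierChar (-⟪time z, freq z⟫) * Real.fourierChar (-⟪s, time z⟫) := by
          simp only [← Circle.coe_mul, ← AddChar.map_add_eq_mul]
          congr 2
          rw [inner_add_right, real_inner_comm s]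
          ring
        simp only [fourier_modulated_gaussian]
        simp only [phaseRotation_apply, time_phasePoint,
          freq_phasePoint, Circle.smul_def, smul_eq_mul, sub_neg_eq_add, hch]
        ring

theorem norm_stft_fourier {d : ℕ} {f : EuclideanSpace ℝ (Fin d) → ℂ} (hf : Integrable f)
    (z : PhaseSpace d) :
    ‖stft gaussian (𝓕 f) z‖ = ‖stft gaussian f (phaseRotation d z)‖ := by
  rw [stft_fourier hf, norm_mul, Circle.norm_coe, one_mul]

/-! ### Norm, completeness and operations on the space -/

namespace S0

variable {d : ℕ}

/-- Integrability of the short-time Fourier transform suffices for membership in `S₀`. -/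
noncomputable def ofIntegrable (f : EuclideanSpace ℝ (Fin d) →ᵇ ℂ)
    (hf : Integrable (stft gaussian f)) : S0 d :=
  ⟨f, memWiener_stft hf⟩

@[simp] theorem toBCF_ofIntegrable (f : EuclideanSpace ℝ (Fin d) →ᵇ ℂ)
    (hf : Integrable (stft gaussian f)) : (ofIntegrable f hf).toBCF = f := rfl

@[simp] theorem toBCF_add (f g : S0 d) : (f + g).toBCF = f.toBCF + g.toBCF := rfl

@[simp] theorem toBCF_sub (f g : S0 d) : (f - g).toBCF = f.toBCF - g.toBCF := rfl

@[simp] theorem toBCF_zero : (0 : S0 d).toBCF = 0 := rfl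

@[simp] theorem toBCF_smul (c : ℂ) (f : S0 d) : (c • f).toBCF = c • f.toBCF := rfl

theorem toBCF_injective : Function.Injective (toBCF : S0 d → _) := Subtype.val_injective

theorem ext {f g : S0 d} (h : ∀ t, f t = g t) : f = g :=
  toBCF_injective (BoundedContinuousFunction.ext h)

theorem integrable_stft (f : S0 d) : Integrable (stft gaussian f) :=
  MemWiener.integrable f.2

theorem memWiener (f : S0 d) : MemWiener f := memWiener_of_integrable_stft f.integrable_stft

theorem integrable (f : S0 d) : Integrable f := f.memWiener.integrable

theorem norm_def (f : S0 d) : ‖f‖ = ∫ z, ‖stft gaussian f z‖ := rfl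

theorem ofReal_norm_eq_lintegral (f : S0 d) :
    ENNReal.ofReal ‖f‖ = ∫⁻ z, ‖stft gaussian f z‖ₑ :=
  ofReal_integral_norm_eq_lintegral_enorm f.integrable_stft

theorem nonneg_norm (f : S0 d) : 0 ≤ ‖f‖ := integral_nonneg fun _ => norm_nonneg _

theorem norm_toBCF_le (f : S0 d) : ‖f.toBCF‖ ≤ ‖f‖ :=
  (BoundedContinuousFunction.norm_le f.nonneg_norm).2
    (norm_apply_le_integral_norm_stft f.integrable_stft)

theorem normedSpaceCore : NormedSpace.Core ℂ (S0 d) where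
  norm_nonneg := nonneg_norm
  norm_smul c f := by
    simp only [norm_def, toBCF_smul, stft_smul, norm_mul, integral_const_mul]
  norm_triangle f g := by
    simp only [norm_def, toBCF_add, stft_add]
    rw [← integral_add f.integrable_stft.norm g.integrable_stft.norm]
    exact integral_mono (f.integrable_stft.add g.integrable_stft).norm
      (f.integrable_stft.norm.add g.integrable_stft.norm) fun z => norm_add_le _ _
  norm_eq_zero_iff f := by
    constructor
    · intro h
      have h0 := f.norm_toBCF_le
      rw [h] at h0
      exact toBCF_injective (norm_le_zero_iff.1 h0)
    · rintro rfl
      simp [norm_def, stft_eq]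

/-- The sup norm is dominated, so a uniform limit exists; the transforms then converge pointwise,
and Fatou's lemma turns the Cauchy estimate into convergence in norm. -/
theorem exists_limit_of_cauchy (u : ℕ → S0 d)
    (hu : ∀ ε > 0, ∃ N, ∀ m ≥ N, ∀ n ≥ N, ‖u m - u n‖ < ε) :
    ∃ f : S0 d, ∀ ε > 0, ∃ N, ∀ n ≥ N, ‖f - u n‖ ≤ ε := by
  have hc : CauchySeq fun n => (u n).toBCF := by
    refine Metric.cauchySeq_iff.2 fun ε hε => ?_
    obtain ⟨N, hN⟩ := hu ε hε
    refine ⟨N, fun m hm n hn => ?_⟩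
    rw [dist_eq_norm, ← toBCF_sub]
    exact (norm_toBCF_le _).trans_lt (hN m hm n hn)
  obtain ⟨f, hf⟩ := cauchySeq_tendsto_of_complete hc
  have hstft : ∀ g z, Filter.Tendsto (fun m => ‖stft gaussian ⇑((u m).toBCF - g) z‖ₑ)
      Filter.atTop (nhds ‖stft gaussian ⇑(f - g) z‖ₑ) := by
    intro g z
    refine (continuous_enorm.tendsto _).comp (tendsto_iff_norm_sub_tendsto_zero.2 ?_)
    refine squeeze_zero (fun _ => norm_nonneg _) (fun m => ?_)
      (tendsto_iff_norm_sub_tendsto_zero.1 hf)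
    rw [← stft_sub, sub_sub_sub_cancel_right]
    exact norm_stft_le _ _
  have hle : ∀ ε > 0, ∃ N, ∀ n ≥ N,
      ∫⁻ z, ‖stft gaussian ⇑(f - (u n).toBCF) z‖ₑ ≤ ENNReal.ofReal ε := by
    intro ε hε
    obtain ⟨N, hN⟩ := hu ε hε
    refine ⟨N, fun n hn => ?_⟩
    calc ∫⁻ z, ‖stft gaussian ⇑(f - (u n).toBCF) z‖ₑ
        = ∫⁻ z, Filter.liminf (fun m => ‖stft gaussian ⇑((u m).toBCF - (u n).toBCF) z‖ₑ)
            Filter.atTop := lintegral_congr fun z => (hstft _ z).liminf_eq.symm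
      _ ≤ Filter.liminf (fun m => ∫⁻ z, ‖stft gaussian ⇑((u m).toBCF - (u n).toBCF) z‖ₑ)
            Filter.atTop :=
          lintegral_liminf_le fun m => (continuous_stft _).enorm.measurable
      _ ≤ ENNReal.ofReal ε := by
          refine Filter.liminf_le_of_frequently_le' (Filter.Eventually.frequently ?_)
          filter_upwards [Filter.eventually_ge_atTop N] with m hm
          rw [← toBCF_sub, ← ofReal_norm_eq_lintegral]
          exact ENNReal.ofReal_le_ofReal (hN m hm n hn).le
  have hint : ∀ n, ∫⁻ z, ‖stft gaussian ⇑(f - (u n).toBCF) z‖ₑ < ∞ →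
      Integrable (stft gaussian ⇑(f - (u n).toBCF)) := fun n h =>
    ⟨(continuous_stft _).aestronglyMeasurable, h⟩
  -- Any finite bound will do here: `f = (f - u N) + u N` then has integrable transform.
  obtain ⟨N, hN⟩ := hle 1 one_pos
  have hfi : Integrable (stft gaussian f) := by
    refine ((hint N ((hN N le_rfl).trans_lt ENNReal.ofReal_lt_top)).add
      (u N).integrable_stft).congr (Filter.Eventually.of_forall fun z => ?_)
    simp only [Pi.add_apply]
    rw [← stft_add, sub_add_cancel]
  refine ⟨ofIntegrable f hfi, fun ε hε => ?_⟩
  obtain ⟨M, hM⟩ := hle ε hε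
  refine ⟨M, fun n hn => ?_⟩
  rw [← ENNReal.ofReal_le_ofReal_iff hε.le, ofReal_norm_eq_lintegral]
  exact hM n hn

theorem integrable_stft_fourier (f : S0 d) :
    Integrable (stft gaussian ⇑(fourierBCF f f.integrable)) := by
  refine ⟨(continuous_stft _).aestronglyMeasurable, ?_⟩
  refine lt_of_eq_of_lt ?_
    ((phaseRotation d).measurePreserving.integrable_comp_of_integrable f.integrable_stft).2
  refine lintegral_congr fun z => ?_
  rw [← ofReal_norm, ← ofReal_norm, coe_fourierBCF, norm_stft_fourier f.integrable]
  rfl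

/-- The Fourier transform on `S₀`. -/
noncomputable def fourier : S0 d →ₗ[ℂ] S0 d where
  toFun f := ofIntegrable (fourierBCF f f.integrable) f.integrable_stft_fourier
  map_add' f g := ext fun s => by
    simp only [toBCF_ofIntegrable, toBCF_add, coe_fourierBCF, BoundedContinuousFunction.coe_add,
      Pi.add_apply, Real.fourier_eq, smul_add]
    exact integral_add ((Real.fourierIntegral_convergent_iff s).2 f.integrable)
      ((Real.fourierIntegral_convergent_iff s).2 g.integrable)
  map_smul' c f := ext fun s => by
    simp only [toBCF_ofIntegrable, toBCF_smul, coe_fourierBCF, BoundedContinuousFunction.coe_smul,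
      Real.fourier_eq, RingHom.id_apply, ← integral_smul, smul_comm c]

theorem coe_fourier (f : S0 d) : ⇑(fourier f).toBCF = 𝓕 (⇑f.toBCF) := rfl

theorem norm_fourier (f : S0 d) : ‖fourier f‖ = ‖f‖ := by
  simp only [norm_def, coe_fourier, norm_stft_fourier f.integrable]
  exact (phaseRotation d).measurePreserving.integral_comp'
    (f := (phaseRotation d).toMeasurableEquiv) (fun z => ‖stft gaussian f z‖)

theorem fourierInv_fourier (f : S0 d) : 𝓕⁻ (𝓕 (⇑f.toBCF)) = f :=
  Continuous.fourierInv_fourier_eq f.toBCF.continuous f.integrable (fourier f).integrable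

theorem fourier_fourier_apply (f : S0 d) (t : EuclideanSpace ℝ (Fin d)) :
    fourier (fourier f) t = f (-t) := by
  have h := congrFun f.fourierInv_fourier (-t)
  rw [Real.fourierInv_eq_fourier_neg, neg_neg] at h
  simpa only [coe_fourier] using h

/-- The square of the Fourier transform is reflection, so its fourth power is the identity and its
cube supplies the preimage. -/
theorem fourier_surjective : Function.Surjective (fourier : S0 d → S0 d) := fun f =>
  ⟨fourier (fourier (fourier f)), ext fun t => by
    rw [fourier_fourier_apply, fourier_fourier_apply, neg_neg]⟩

theorem integrable_stft_timeFreqShift (x ω : EuclideanSpace ℝ (Fin d)) (f : S0 d) :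
    Integrable (stft gaussian ⇑(timeFreqShift x ω f.toBCF)) := by
  refine ⟨(continuous_stft _).aestronglyMeasurable, ?_⟩
  refine lt_of_eq_of_lt ?_ (f.integrable_stft.comp_sub_right (phasePoint x ω)).2
  refine lintegral_congr fun z => ?_
  rw [← ofReal_norm, ← ofReal_norm, norm_stft_timeFreqShift]

/-- The time-frequency shift on `S₀`. -/
noncomputable def shift (x ω : EuclideanSpace ℝ (Fin d)) : S0 d →ₗ[ℂ] S0 d where
  toFun f := ofIntegrable (timeFreqShift x ω f.toBCF) (integrable_stft_timeFreqShift x ω f)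
  map_add' f g := ext fun t => by simp [mul_add]
  map_smul' c f := ext fun t => by simp [mul_left_comm]

theorem shift_apply (x ω : EuclideanSpace ℝ (Fin d)) (f : S0 d) (t : EuclideanSpace ℝ (Fin d)) :
    shift x ω f t = (Real.fourierChar ⟪ω, t⟫ : ℂ) * f (t - x) := rfl

theorem norm_shift (x ω : EuclideanSpace ℝ (Fin d)) (f : S0 d) : ‖shift x ω f‖ = ‖f‖ := by
  change ∫ z, ‖stft gaussian ⇑(timeFreqShift x ω f.toBCF) z‖ = _
  simp only [norm_stft_timeFreqShift]
  exact integral_sub_right_eq_self (fun z => ‖stft gaussian f z‖) (phasePoint x ω)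

theorem shift_surjective (x ω : EuclideanSpace ℝ (Fin d)) :
    Function.Surjective (shift x ω) := fun f => by
  -- Modulation and translation commute only up to a phase; this scalar corrects it.
  refine ⟨(Real.fourierChar (-⟪ω, x⟫) : ℂ) • shift (-x) (-ω) f, ext fun t => ?_⟩
  have hch : (Real.fourierChar ⟪ω, t⟫ : ℂ) * (Real.fourierChar (-⟪ω, x⟫) *
      Real.fourierChar ⟪-ω, t - x⟫) = 1 := by
    simp only [← Circle.coe_mul, ← AddChar.map_add_eq_mul]
    rw [inner_neg_left, inner_sub_right,
      show ⟪ω, t⟫ + (-⟪ω, x⟫ + -(⟪ω, t⟫ - ⟪ω, x⟫)) = 0 by ring]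
    simp
  calc _ = (Real.fourierChar ⟪ω, t⟫ : ℂ) * (Real.fourierChar (-⟪ω, x⟫) *
        (Real.fourierChar ⟪-ω, t - x⟫ * f (t - x - -x))) := rfl
    _ = _ := by
      rw [← mul_assoc (Real.fourierChar (-⟪ω, x⟫) : ℂ), ← mul_assoc, hch, one_mul,
        sub_neg_eq_add, sub_add_cancel]

theorem integrable_stft_mul (f g : S0 d) :
    Integrable (stft gaussian ⇑(f.toBCF * g.toBCF)) :=
  ⟨(continuous_stft _).aestronglyMeasurable,
    (lintegral_stft_mul_le f.integrable_stft g.toBCF).trans_lt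
      (ENNReal.mul_lt_top f.integrable_stft.2 g.integrable_stft.2)⟩

/-- The pointwise product on `S₀`. -/
noncomputable def mul : S0 d →ₗ[ℂ] S0 d →ₗ[ℂ] S0 d :=
  LinearMap.mk₂ ℂ (fun f g => ofIntegrable (f.toBCF * g.toBCF) (integrable_stft_mul f g))
    (fun _ _ _ => toBCF_injective (add_mul _ _ _))
    (fun _ _ _ => toBCF_injective (smul_mul_assoc _ _ _))
    (fun _ _ _ => toBCF_injective (mul_add _ _ _))
    (fun _ _ _ => toBCF_injective (mul_smul_comm _ _ _))

theorem mul_apply (f g : S0 d) (t : EuclideanSpace ℝ (Fin d)) : mul f g t = f t * g t := rfl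

theorem mul_assoc' (f g h : S0 d) : mul (mul f g) h = mul f (mul g h) :=
  ext fun _ => mul_assoc _ _ _

theorem norm_mul_le' (f g : S0 d) : ‖mul f g‖ ≤ ‖f‖ * ‖g‖ := by
  rw [← ENNReal.ofReal_le_ofReal_iff (mul_nonneg f.nonneg_norm g.nonneg_norm),
    ENNReal.ofReal_mul f.nonneg_norm]
  simp only [ofReal_norm_eq_lintegral]
  exact lintegral_stft_mul_le f.integrable_stft g.toBCF

theorem bddAbove_range_norm (f : S0 d) : BddAbove (Set.range fun t => ‖f t‖) :=
  ⟨‖f.toBCF‖, by rintro _ ⟨t, rfl⟩; exact f.toBCF.norm_coe_le_norm t⟩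

theorem convolutionExists (f g : S0 d) :
    ConvolutionExists f g (ContinuousLinearMap.mul ℂ ℂ) volume := fun _ =>
  BddAbove.convolutionExistsAt _ (s := Set.univ)
    (g.bddAbove_range_norm.mono (Set.image_subset_range _ _)) MeasurableSet.univ
    (Set.subset_univ _) f.integrable.integrableOn g.toBCF.continuous.aestronglyMeasurable

/-- Both sides are continuous and integrable with the same integrable Fourier transform, so Fourier
inversion identifies them at every point. -/
theorem eq_convolution_of_fourier_eq_mul {f g h : S0 d}
    (hh : fourier h = mul (fourier f) (fourier g)) :
    ⇑h.toBCF = f ⋆[ContinuousLinearMap.mul ℂ ℂ, volume] g := by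
  have hF : 𝓕 (f ⋆[ContinuousLinearMap.mul ℂ ℂ, volume] g) = 𝓕 (⇑h.toBCF) := by
    funext s
    rw [← coe_fourier, hh, Real.fourier_mul_convolution_eq f.integrable g.integrable]
    rfl
  rw [← h.fourierInv_fourier, ← hF]
  refine (Continuous.fourierInv_fourier_eq ?_
    (f.integrable.integrable_convolution _ g.integrable) ?_)
  · exact g.bddAbove_range_norm.continuous_convolution_right_of_integrable _ f.integrable
      g.toBCF.continuous
  · rw [hF]
    exact (fourier h).integrable

end S0

end Feichtinger

/-! ### The main theorem -/

theorem mainTheorem1 (d : ℕ) :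
    -- `S₀(ℝᵈ) ⊆ W(ℝᵈ) ⊆ L¹(ℝᵈ)`, and the `L¹` norm of `V_{g₀} f`, the Fourier transform and the
    -- convolution are given by absolutely convergent integrals
    (∀ f : Feichtinger.S0 d, Feichtinger.MemWiener f ∧ Integrable f volume ∧
      Integrable (Feichtinger.stft Feichtinger.gaussian f) volume) ∧
    (∀ f g : Feichtinger.S0 d,
      ConvolutionExists f g (ContinuousLinearMap.mul ℂ ℂ) volume) ∧
    -- the norm of `S₀(ℝᵈ)` satisfies the axioms of a norm
    ∃ core : NormedSpace.Core ℂ (Feichtinger.S0 d),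
      letI : NormedAddCommGroup (Feichtinger.S0 d) := NormedAddCommGroup.ofCore core
      -- completeness
      CompleteSpace (Feichtinger.S0 d) ∧
      -- the Fourier transform is a linear isometric bijection of `S₀(ℝᵈ)`
      (∃ F : Feichtinger.S0 d ≃ₗᵢ[ℂ] Feichtinger.S0 d,
        ∀ (f : Feichtinger.S0 d) (s : EuclideanSpace ℝ (Fin d)), F f s = 𝓕 (⇑f.toBCF) s) ∧
      -- every time-frequency shift `E_ω T_x` is a linear isometric bijection of `S₀(ℝᵈ)`
      (∀ x ω : EuclideanSpace ℝ (Fin d), ∃ U : Feichtinger.S0 d ≃ₗᵢ[ℂ] Feichtinger.S0 d,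
        ∀ (f : Feichtinger.S0 d) (t : EuclideanSpace ℝ (Fin d)),
          U f t = Complex.exp (2 * Real.pi * Complex.I * (inner ℝ ω t : ℝ)) * f (t - x)) ∧
      -- Banach algebra under pointwise multiplication
      (∃ m : Feichtinger.S0 d →ₗ[ℂ] Feichtinger.S0 d →ₗ[ℂ] Feichtinger.S0 d,
        (∀ (f g : Feichtinger.S0 d) (t : EuclideanSpace ℝ (Fin d)), m f g t = f t * g t) ∧
        (∀ f g h : Feichtinger.S0 d, m (m f g) h = m f (m g h)) ∧
        (∀ f g : Feichtinger.S0 d, ‖m f g‖ ≤ ‖f‖ * ‖g‖)) ∧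
      -- Banach algebra under convolution
      (∃ c : Feichtinger.S0 d →ₗ[ℂ] Feichtinger.S0 d →ₗ[ℂ] Feichtinger.S0 d,
        (∀ (f g : Feichtinger.S0 d) (t : EuclideanSpace ℝ (Fin d)),
          c f g t = (f ⋆[ContinuousLinearMap.mul ℂ ℂ, volume] g) t) ∧
        (∀ f g h : Feichtinger.S0 d, c (c f g) h = c f (c g h)) ∧
        (∀ f g : Feichtinger.S0 d, ‖c f g‖ ≤ ‖f‖ * ‖g‖)) := by
  refine ⟨fun f => ⟨f.memWiener, f.integrable, f.integrable_stft⟩,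
    fun f g => f.convolutionExists g, Feichtinger.S0.normedSpaceCore, ?_⟩
  have core := Feichtinger.S0.normedSpaceCore (d := d)
  let _ : NormedAddCommGroup (Feichtinger.S0 d) := NormedAddCommGroup.ofCore core
  let _ : NormedSpace ℂ (Feichtinger.S0 d) := NormedSpace.ofCore core
  let F : Feichtinger.S0 d ≃ₗᵢ[ℂ] Feichtinger.S0 d := LinearIsometryEquiv.ofSurjective
    ⟨Feichtinger.S0.fourier, Feichtinger.S0.norm_fourier⟩ Feichtinger.S0.fourier_surjective
  have hF : ∀ f, F f = Feichtinger.S0.fourier f := fun _ => rfl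
  refine ⟨?_, ⟨F, fun f s => rfl⟩, fun x ω => ⟨LinearIsometryEquiv.ofSurjective
    ⟨Feichtinger.S0.shift x ω, Feichtinger.S0.norm_shift x ω⟩
    (Feichtinger.S0.shift_surjective x ω), fun f t => ?_⟩,
    ⟨Feichtinger.S0.mul, Feichtinger.S0.mul_apply, Feichtinger.S0.mul_assoc',
      Feichtinger.S0.norm_mul_le'⟩, ?_⟩
  · refine Metric.complete_of_cauchySeq_tendsto fun u hu => ?_
    obtain ⟨f, hf⟩ := Feichtinger.S0.exists_limit_of_cauchy u fun ε hε => by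
      obtain ⟨N, hN⟩ := Metric.cauchySeq_iff.1 hu ε hε
      exact ⟨N, fun m hm n hn => by simpa only [dist_eq_norm] using! hN m hm n hn⟩
    refine ⟨f, Metric.tendsto_atTop.2 fun ε hε => ?_⟩
    obtain ⟨N, hN⟩ := hf (ε / 2) (half_pos hε)
    refine ⟨N, fun n hn => ?_⟩
    rw [dist_comm, dist_eq_norm]
    exact (hN n hn).trans_lt (half_lt_self hε)
  · change Feichtinger.S0.shift x ω f t = _
    rw [Feichtinger.S0.shift_apply, Real.fourierChar_apply]
    congr 2
    push_cast
    ring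
  -- Defining convolution as `F⁻¹(F f · F g)` makes bilinearity, associativity and the norm bound
  -- inherit from the pointwise product; only agreement with the integral needs an argument.
  · let c : Feichtinger.S0 d →ₗ[ℂ] Feichtinger.S0 d →ₗ[ℂ] Feichtinger.S0 d :=
      (Feichtinger.S0.mul.compl₁₂ F.toLinearMap F.toLinearMap).compr₂ F.symm.toLinearMap
    have hc : ∀ f g, c f g = F.symm (Feichtinger.S0.mul (F f) (F g)) := fun _ _ => rfl
    refine ⟨c, fun f g t => ?_, fun f g h => ?_, fun f g => ?_⟩
    · refine congrFun (Feichtinger.S0.eq_convolution_of_fourier_eq_mul ?_) t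
      rw [hc, ← hF, F.apply_symm_apply, hF, hF]
    · simp only [hc, F.apply_symm_apply, Feichtinger.S0.mul_assoc']
    · refine (F.symm.norm_map _).trans_le ?_
      rw [← F.norm_map f, ← F.norm_map g]
      exact Feichtinger.S0.norm_mul_le' (F f) (F g)
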